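/- Let $K$ be a field of characteristic $0$ (e.g. $\mathbb R$ or $\mathbb C$) and let $\mathfrak A$ be an associative $K$-algebra with neutral element $1$; write $[\mathcal A,\mathcal B]=\mathcal A\mathcal B-\mathcal B\mathcal A$. For $n\ge 0$ and $\mathcal A_1,\dots,\mathcal A_n\in\mathfrak A$ let \[ \mathrm{Sym}_n(\mathcal A_1,\dots,\mathcal A_n)=\frac1{n!}\sum_{\pi\in\Pi_n}\mathcal A_{\pi(1)}\mathcal A_{\pi(2)}\cdots\mathcal A_{\pi(n)}, \] where $\Pi_n$ is the set of all permutations of $\{1,\dots,n\}$ (so $\mathrm{Sym}_0=1$). Let $\mathcal L_1,\dots,\mathcal L_l$ and $\mathcal M_1,\dots,\mathcal M_m$ be elements of $\mathfrak A$ such that $[\mathcal L_i,\mathcal M_j]=d_{ij}\,1$ with $d_{ij}\in K$ for all $1\le i\le l$, $1\le j\le m$ (nothing is assumed on $[\mathcal L_i,\mathcal L_j]$ and $[\mathcal M_i,\mathcal M_j]$). Then \[ [\mathrm{Sym}_l(\mathcal L_1,\dots,\mathcal L_l),\mathrm{Sym}_m(\mathcal M_1,\dots,\mathcal M_m)] =\sum_{h\in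 H}\ \sum_{I\in P_{h,l}}\ \sum_{J\in P_{h,m}}\ \sum_{\pi\in\Pi_h}\frac1{2^{h-1}}\,d_{i_1j_{\pi(1)}}\cdots d_{i_hj_{\pi(h)}}\ \mathrm{Sym}_{l+m-2h}(\mathcal L_{i'_1},\dots,\mathcal L_{i'_{l-h}},\mathcal M_{j'_1},\dots,\mathcal M_{j'_{m-h}}), \] where $H$ is the set of all odd integers $h$ with $1\le h\le\min(l,m)$, $P_{h,n}$ is the set of all subsets of $\{1,\dots,n\}$ with exactly $h$ elements, $I=\{i_1<\dots<i_h\}$, $J=\{j_1<\dots<j_h\}$, and $i'_1<\dots<i'_{l-h}$ and $j'_1<\dots<j'_{m-h}$ are the elements of the complements $\{1,\dots,l\}\setminus I$ and $\{1,\dots,m\}\setminus J$. -/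

import Mathlib

/-- The symmetrized product `Sym_n(a_1, …, a_n) = (1/n!) ∑_π a_{π(1)} ⋯ a_{π(n)}` of `n` elements
of an associative algebra (for `n = 0` it is the neutral element). -/
noncomputable def symProd (K : Type*) {A : Type*} [Field K] [Ring A] [Algebra K A]
    {n : ℕ} (a : Fin n → A) : A :=
  (1 / (n.factorial : K)) • ∑ π : Equiv.Perm (Fin n), (List.ofFn fun r => a (π r)).prod

/-- The set `P_{h,m}` of the parts of an index set with `m` elements which contain exactly `h`
elements. -/
abbrev Parts (h m : ℕ) : Type := {I : Finset (Fin m) // I.card = h}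

/-- The elements `i_1 < … < i_h` of a part `I` with `h` elements. -/
def Parts.elem {h m : ℕ} (I : Parts h m) : Fin h → Fin m :=
  I.1.orderEmbOfFin I.2

theorem Parts.card_compl {h m : ℕ} (I : Parts h m) : (I.1)ᶜ.card = m - h := by
  rw [Finset.card_compl, Fintype.card_fin, I.2]

/-- The elements `i'_1 < … < i'_{m-h}` of the complement of a part `I` with `h` elements. -/
def Parts.complElem {h m : ℕ} (I : Parts h m) : Fin (m - h) → Fin m :=
  (I.1)ᶜ.orderEmbOfFin I.card_compl

/-! This is a Wick expansion. `Sym(L) * Sym(M)` equals the sum, over all partial matchings between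
the two index sets, of the product of the weights `d i j / 2` of the matched pairs times the
symmetrized product of all unmatched elements. `Sym(M) * Sym(L)` has the same expansion with weights
`-d i j / 2`. In the difference, matchings with an even number of pairs cancel, and those with `h`
odd pairs get `2 * (1/2)^h = 1/2^(h-1)`.

Each expansion is proved by uniqueness of solutions. The product and the matching sum, as functions
`F U V` of finite index sets, satisfy one recursion for `(|U| + |V|) • F U V`, obtained by
extracting one factor at the front (`card_add_card_smul_contractionSum`). In characteristic zero it
determines `F` from `F ∅ ∅ = 1` (`eq_contractionSum`). -/

open Finset

/-! ### Permutation sums as recursions over finite sets -/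

section OrderedProducts

variable {ι κ A : Type*} [DecidableEq ι] [DecidableEq κ] [Ring A]

/-- The sum of the products `x i₁ ⋯ x iₙ` over all sequences of `n` distinct elements of `W`. -/
def orderedProdSum (x : ι → A) : ℕ → Finset ι → A
  | 0, _ => 1
  | n + 1, W => ∑ i ∈ W, x i * orderedProdSum x n (W.erase i)

theorem image_comp_swap_succ {n : ℕ} (e : Fin (n + 1) → ι) (he : Function.Injective e)
    (p : Fin (n + 1)) :
    univ.image (fun r : Fin n => e (Equiv.swap 0 p r.succ)) = (univ.image e).erase (e p) := by
  ext i
  simp only [mem_image, mem_univ, true_and, mem_erase]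
  constructor
  · rintro ⟨r, rfl⟩
    refine ⟨fun h => ?_, _, rfl⟩
    have h1 := congrArg (Equiv.swap 0 p) (he h)
    simp only [Equiv.swap_apply_self, Equiv.swap_apply_right] at h1
    exact Fin.succ_ne_zero r h1
  · rintro ⟨hne, q, rfl⟩
    have hq : Equiv.swap 0 p q ≠ 0 := by
      intro h
      apply hne
      have h1 := congrArg (Equiv.swap 0 p) h
      simp only [Equiv.swap_apply_self, Equiv.swap_apply_left] at h1
      rw [h1]
    obtain ⟨r, hr⟩ := Fin.exists_succ_eq.mpr hq
    exact ⟨r, by rw [hr, Equiv.swap_apply_self]⟩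

omit [DecidableEq ι] in
theorem injective_comp_swap_succ {n : ℕ} (e : Fin (n + 1) → ι) (he : Function.Injective e)
    (p : Fin (n + 1)) :
    Function.Injective (fun r : Fin n => e (Equiv.swap 0 p r.succ)) :=
  he.comp ((Equiv.swap 0 p).injective.comp (Fin.succ_injective n))

/-- Permutations are split by their value `p` at `0`; the tail then runs through an enumeration of
the index set without `e p`. -/
theorem sum_perm_eq_orderedProdSum (x : ι → A) {n : ℕ} (e : Fin n → ι)
    (he : Function.Injective e) :
    ∑ π : Equiv.Perm (Fin n), (List.ofFn fun r => x (e (π r))).prod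
      = orderedProdSum x n (univ.image e) := by
  induction n with
  | zero => simp [orderedProdSum]
  | succ n ih =>
    rw [← Equiv.sum_comp Equiv.Perm.decomposeFin.symm, Fintype.sum_prod_type, orderedProdSum,
      sum_image he.injOn]
    refine sum_congr rfl fun p _ => ?_
    rw [← image_comp_swap_succ e he p, ← ih _ (injective_comp_swap_succ e he p), mul_sum]
    refine sum_congr rfl fun π _ => ?_
    simp [List.ofFn_succ]

/-- The sum of the products `d i₁ j₁ ⋯ d iₙ jₙ` over all sequences of `n` distinct elements of `U`
and all enumerations of `V`. -/
def orderedPairSum {R : Type*} [CommRing R] (d : ι → κ → R) : ℕ → Finset ι → Finset κ → R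
  | 0, _, V => if V = ∅ then 1 else 0
  | n + 1, U, V => ∑ i ∈ U, ∑ j ∈ V, d i j * orderedPairSum d n (U.erase i) (V.erase j)

theorem sum_perm_perm_eq_orderedPairSum {R : Type*} [CommRing R] (d : ι → κ → R) {n : ℕ}
    (e : Fin n → ι) (f : Fin n → κ) (he : Function.Injective e) (hf : Function.Injective f) :
    ∑ ρ : Equiv.Perm (Fin n), ∑ π : Equiv.Perm (Fin n), ∏ r, d (e (ρ r)) (f (π r))
      = orderedPairSum d n (univ.image e) (univ.image f) := by
  induction n with
  | zero => simp [orderedPairSum]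
  | succ n ih =>
    rw [← Equiv.sum_comp Equiv.Perm.decomposeFin.symm, Fintype.sum_prod_type, orderedPairSum,
      sum_image he.injOn]
    refine sum_congr rfl fun p _ => ?_
    rw [sum_image hf.injOn]
    simp_rw [fun ρ => (Equiv.sum_comp Equiv.Perm.decomposeFin.symm
      (fun π : Equiv.Perm (Fin (n + 1)) => ∏ r,
        d (e (Equiv.Perm.decomposeFin.symm (p, ρ) r)) (f (π r)))).symm, Fintype.sum_prod_type]
    rw [sum_comm]
    refine sum_congr rfl fun q _ => ?_
    rw [← image_comp_swap_succ e he p, ← image_comp_swap_succ f hf q,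
      ← ih _ _ (injective_comp_swap_succ e he p) (injective_comp_swap_succ f hf q), mul_sum]
    refine sum_congr rfl fun ρ _ => ?_
    rw [mul_sum]
    refine sum_congr rfl fun π _ => ?_
    simp [Fin.prod_univ_succ]

/-- Ordering rows and columns independently counts each bijection once per ordering of its pairs;
substituting `π * ρ` for `π` removes `ρ`. -/
theorem sum_perm_perm_eq_factorial_mul {R : Type*} [CommRing R] {n : ℕ} (d : Fin n → Fin n → R) :
    ∑ ρ : Equiv.Perm (Fin n), ∑ π : Equiv.Perm (Fin n), ∏ r, d (ρ r) (π r)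
      = (n.factorial : R) * ∑ π : Equiv.Perm (Fin n), ∏ r, d r (π r) := by
  have h (ρ : Equiv.Perm (Fin n)) : ∑ π : Equiv.Perm (Fin n), ∏ r, d (ρ r) (π r)
      = ∑ π : Equiv.Perm (Fin n), ∏ r, d r (π r) := by
    rw [← Equiv.sum_comp (Equiv.mulRight ρ)]
    refine sum_congr rfl fun π _ => ?_
    exact Equiv.prod_comp ρ fun r => d r (π r)
  simp [h, Fintype.card_perm]

/-- Each step removes one element of `V`, and the base case requires that none is left. Hence
matchings can be summed over all pairs of subsets, with no condition on sizes. -/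
theorem orderedPairSum_eq_zero {R : Type*} [CommRing R] (d : ι → κ → R) {n : ℕ} {U : Finset ι}
    {V : Finset κ} (h : V.card ≠ n) : orderedPairSum d n U V = 0 := by
  induction n generalizing U V with
  | zero => simp [orderedPairSum, card_ne_zero.mp h |>.ne_empty]
  | succ n ih =>
    refine sum_eq_zero fun i _ => sum_eq_zero fun j hj => ?_
    rw [ih, mul_zero]
    have := card_pos.mpr ⟨j, hj⟩
    rw [card_erase_of_mem hj]
    omega

theorem orderedPairSum_smul {R : Type*} [CommRing R] (k : R) (d : ι → κ → R) (n : ℕ)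
    (U : Finset ι) (V : Finset κ) :
    orderedPairSum (fun i j => k * d i j) n U V = k ^ n * orderedPairSum d n U V := by
  induction n generalizing U V with
  | zero => simp [orderedPairSum]
  | succ n ih =>
    simp only [orderedPairSum, ih, mul_sum]
    refine sum_congr rfl fun i _ => sum_congr rfl fun j _ => ?_
    ring

theorem sum_powerset_sum_sdiff {B : Type*} [AddCommMonoid B] (U : Finset ι)
    (f : Finset ι → ι → B) :
    ∑ I ∈ U.powerset, ∑ i ∈ U \ I, f I i = ∑ i ∈ U, ∑ I ∈ (U.erase i).powerset, f I i := by
  refine sum_comm' fun I i => ?_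
  simp only [mem_powerset, mem_sdiff, subset_erase]
  tauto

theorem sum_powerset_sum_mem {B : Type*} [AddCommMonoid B] (U : Finset ι)
    (f : Finset ι → ι → B) :
    ∑ I ∈ U.powerset, ∑ i ∈ I, f I i
      = ∑ i ∈ U, ∑ I ∈ (U.erase i).powerset, f (insert i I) i := by
  rw [sum_comm' (t' := U) (s' := fun i => U.powerset.filter (i ∈ ·))]
  · refine sum_congr rfl fun i hi => ?_
    refine sum_bij' (fun I _ => I.erase i) (fun I _ => insert i I) ?_ ?_ ?_ ?_ ?_
    · intro I hI
      simp only [mem_filter, mem_powerset] at hI ⊢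
      exact erase_subset_erase i hI.1
    · intro I hI
      simp only [mem_filter, mem_powerset, subset_erase] at hI ⊢
      exact ⟨insert_subset hi hI.1, mem_insert_self i I⟩
    · intro I hI
      exact insert_erase (mem_filter.mp hI).2
    · intro I hI
      exact erase_insert (subset_erase.mp (mem_powerset.mp hI)).2
    · intro I hI
      rw [insert_erase (mem_filter.mp hI).2]
  · intro I i
    simp only [mem_filter, mem_powerset]
    exact ⟨fun h => ⟨⟨h.1, h.2⟩, h.1 h.2⟩, fun h => h.1⟩

end OrderedProducts

/-! ### Symmetrized products, matchings and the Wick expansion -/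

section Symmetrization

variable {K A ι κ : Type*} [Field K] [CharZero K] [Ring A] [Algebra K A] [DecidableEq ι]
  [DecidableEq κ]

variable (K) in
/-- The symmetrized product of the elements `x i` with `i ∈ W`. -/
noncomputable def symFinset (x : ι → A) (W : Finset ι) : A :=
  (1 / (W.card.factorial : K)) • orderedProdSum x W.card W

omit [CharZero K] in
theorem symProd_comp_eq_symFinset (x : ι → A) {n : ℕ} (e : Fin n → ι)
    (he : Function.Injective e) :
    symProd K (fun r => x (e r)) = symFinset K x (univ.image e) := by
  rw [symProd, symFinset, sum_perm_eq_orderedProdSum x e he, card_image_of_injective _ he,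
    card_univ, Fintype.card_fin]

theorem symFinset_empty (x : ι → A) : symFinset K x ∅ = 1 := by
  simp [symFinset, orderedProdSum]

theorem card_smul_symFinset (x : ι → A) (W : Finset ι) :
    (W.card : K) • symFinset K x W = ∑ i ∈ W, x i * symFinset K x (W.erase i) := by
  rcases h : W.card with _ | n
  · simp [card_eq_zero.mp h]
  · rw [symFinset, h, orderedProdSum, smul_smul, smul_sum]
    refine sum_congr rfl fun i hi => ?_
    rw [symFinset, card_erase_of_mem hi, h, Nat.add_sub_cancel, mul_smul_comm]
    congr 1
    have := Nat.cast_add_one_ne_zero (R := K) n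
    rw [Nat.factorial_succ]
    push_cast
    field_simp

/-- Commutation with `z` is a derivation, and here it replaces one factor at a time by a scalar. -/
theorem symFinset_comm (x : ι → A) (z : A) (δ : ι → K)
    (hz : ∀ i, z * x i = x i * z + algebraMap K A (δ i)) (W : Finset ι) :
    z * symFinset K x W = symFinset K x W * z + ∑ i ∈ W, δ i • symFinset K x (W.erase i) := by
  induction hn : W.card generalizing W with
  | zero => simp [card_eq_zero.mp hn, symFinset_empty]
  | succ n ih =>
    have hn0 := Nat.cast_add_one_ne_zero (R := K) n
    refine smul_right_injective A hn0 ?_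
    have hW : ((n : K) + 1) = (W.card : K) := by rw [hn]; push_cast; rfl
    have hE {i : ι} (hi : i ∈ W) : (W.erase i).card = n := by
      rw [card_erase_of_mem hi, hn, Nat.add_sub_cancel]
    change ((n : K) + 1) • _ = ((n : K) + 1) • _
    -- For fixed `j`, the sum over the first factor `i` reassembles `n` copies of the product
    -- without `j`; the term where `z` meets the first factor supplies the missing copy.
    have h1 : ∑ i ∈ W, ∑ j ∈ W.erase i, δ j • (x i * symFinset K x ((W.erase i).erase j))
        = (n : K) • ∑ i ∈ W, δ i • symFinset K x (W.erase i) := by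
      rw [sum_comm' (t' := W) (s' := fun j => W.erase j)
        (by intro i j; simp only [mem_erase]; tauto), smul_sum]
      refine sum_congr rfl fun j hj => ?_
      rw [smul_comm, ← hE hj, card_smul_symFinset, smul_sum]
      refine sum_congr rfl fun i _ => ?_
      rw [erase_right_comm]
    have h2 : ((n : K) + 1) • (z * symFinset K x W)
        = ∑ i ∈ W, (x i * symFinset K x (W.erase i) * z
          + ∑ j ∈ W.erase i, δ j • (x i * symFinset K x ((W.erase i).erase j))
          + δ i • symFinset K x (W.erase i)) := by
      rw [hW, ← mul_smul_comm, card_smul_symFinset, mul_sum]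
      refine sum_congr rfl fun i hi => ?_
      rw [← mul_assoc, hz, add_mul, mul_assoc, ih _ (hE hi), mul_add, ← mul_assoc, mul_sum,
        Algebra.smul_def]
      simp_rw [mul_smul_comm]
    rw [h2, sum_add_distrib, sum_add_distrib, h1, ← sum_mul, ← card_smul_symFinset, smul_add,
      ← hW, smul_mul_assoc, add_smul, add_smul, one_smul, one_smul]
    abel

/-- The symmetrized product of the elements `L i` with `i ∈ U` and `M j` with `j ∈ V`. -/
noncomputable abbrev symPair (K : Type*) [Field K] [Algebra K A] (L : ι → A) (M : κ → A)
    (U : Finset ι) (V : Finset κ) : A :=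
  symFinset K (Sum.elim L M) (U.disjSum V)

theorem disjSum_erase_inl (U : Finset ι) (V : Finset κ) (i : ι) :
    (U.disjSum V).erase (Sum.inl i) = (U.erase i).disjSum V := by
  ext (a | a) <;> simp

theorem disjSum_erase_inr (U : Finset ι) (V : Finset κ) (j : κ) :
    (U.disjSum V).erase (Sum.inr j) = U.disjSum (V.erase j) := by
  ext (a | a) <;> simp

theorem card_add_card_smul_symPair (L : ι → A) (M : κ → A) (U : Finset ι) (V : Finset κ) :
    ((U.card : K) + V.card) • symPair K L M U V
      = ∑ i ∈ U, L i * symPair K L M (U.erase i) V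
        + ∑ j ∈ V, M j * symPair K L M U (V.erase j) := by
  rw [← Nat.cast_add, ← card_disjSum, card_smul_symFinset, sum_disjSum]
  simp_rw [disjSum_erase_inl, disjSum_erase_inr, Sum.elim_inl, Sum.elim_inr]

/-- The sum of the products `∏ i ∈ I, d i (σ i)` over all bijections `σ` from `I` to `J`. -/
noncomputable def bijSum (d : ι → κ → K) (I : Finset ι) (J : Finset κ) : K :=
  (1 / (I.card.factorial : K)) * orderedPairSum d I.card I J

theorem sum_perm_prod_eq_bijSum (d : ι → κ → K) {n : ℕ} (e : Fin n → ι) (f : Fin n → κ)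
    (he : Function.Injective e) (hf : Function.Injective f) :
    ∑ π : Equiv.Perm (Fin n), ∏ r, d (e r) (f (π r))
      = bijSum d (univ.image e) (univ.image f) := by
  have h0 : (n.factorial : K) ≠ 0 := Nat.cast_ne_zero.mpr n.factorial_ne_zero
  rw [bijSum, card_image_of_injective _ he, card_univ, Fintype.card_fin,
    ← sum_perm_perm_eq_orderedPairSum d e f he hf,
    sum_perm_perm_eq_factorial_mul (fun i j => d (e i) (f j)), one_div,
    inv_mul_cancel_left₀ h0]

omit [CharZero K] in
theorem bijSum_eq_zero (d : ι → κ → K) {I : Finset ι} {J : Finset κ} (h : J.card ≠ I.card) :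
    bijSum d I J = 0 := by
  rw [bijSum, orderedPairSum_eq_zero d h, mul_zero]

theorem bijSum_smul (k : K) (d : ι → κ → K) (I : Finset ι) (J : Finset κ) :
    bijSum (fun i j => k * d i j) I J = k ^ I.card * bijSum d I J := by
  rw [bijSum, bijSum, orderedPairSum_smul]
  ring

theorem card_mul_bijSum (d : ι → κ → K) (I : Finset ι) (J : Finset κ) :
    (I.card : K) * bijSum d I J
      = ∑ i ∈ I, ∑ j ∈ J, d i j * bijSum d (I.erase i) (J.erase j) := by
  rcases h : I.card with _ | n
  · simp [card_eq_zero.mp h]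
  · rw [bijSum, h, orderedPairSum, ← mul_assoc, mul_sum]
    refine sum_congr rfl fun i hi => ?_
    rw [mul_sum]
    refine sum_congr rfl fun j _ => ?_
    rw [bijSum, card_erase_of_mem hi, h, Nat.add_sub_cancel]
    have := Nat.cast_add_one_ne_zero (R := K) n
    rw [Nat.factorial_succ]
    push_cast
    field_simp

/-- The sum over all partial matchings between `U` and `V` of the product of the weights `d i j` of
the matched pairs times the symmetrized product of the unmatched elements. -/
noncomputable def contractionSum (L : ι → A) (M : κ → A) (d : ι → κ → K)
    (U : Finset ι) (V : Finset κ) : A :=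
  ∑ I ∈ U.powerset, ∑ J ∈ V.powerset, bijSum d I J • symPair K L M (U \ I) (V \ J)

theorem contractionSum_empty (L : ι → A) (M : κ → A) (d : ι → κ → K) :
    contractionSum L M d ∅ ∅ = 1 := by
  simp [contractionSum, symPair, bijSum, orderedPairSum, symFinset_empty]

/-- The factor `I.card` marks one pair of the matching; removing it leaves an arbitrary matching of
the remaining indices. -/
theorem sum_card_smul_contraction (L : ι → A) (M : κ → A) (d : ι → κ → K)
    (U : Finset ι) (V : Finset κ) :
    ∑ I ∈ U.powerset, ∑ J ∈ V.powerset,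
        ((I.card : K) * bijSum d I J) • symPair K L M (U \ I) (V \ J)
      = ∑ i ∈ U, ∑ j ∈ V, d i j • contractionSum L M d (U.erase i) (V.erase j) := by
  have h1 : ∀ I ∈ U.powerset, ∑ J ∈ V.powerset,
        ((I.card : K) * bijSum d I J) • symPair K L M (U \ I) (V \ J)
      = ∑ i ∈ I, ∑ j ∈ V, ∑ J ∈ (V.erase j).powerset,
        (d i j * bijSum d (I.erase i) J) • symPair K L M (U \ I) (V.erase j \ J) := by
    intro I _
    simp_rw [card_mul_bijSum, sum_smul]
    rw [sum_comm]
    refine sum_congr rfl fun i _ => ?_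
    rw [sum_powerset_sum_mem]
    refine sum_congr rfl fun j _ => sum_congr rfl fun J hJ => ?_
    rw [erase_insert (subset_erase.mp (mem_powerset.mp hJ)).2, sdiff_insert, erase_sdiff_comm]
  rw [sum_congr rfl h1, sum_powerset_sum_mem]
  refine sum_congr rfl fun i _ => ?_
  rw [sum_comm]
  refine sum_congr rfl fun j _ => ?_
  rw [contractionSum, smul_sum]
  refine sum_congr rfl fun I hI => ?_
  rw [smul_sum]
  refine sum_congr rfl fun J _ => ?_
  rw [erase_insert (subset_erase.mp (mem_powerset.mp hI)).2, mul_smul, sdiff_insert,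
    erase_sdiff_comm U]

theorem card_add_card_smul_contractionSum (L : ι → A) (M : κ → A) (d : ι → κ → K)
    (U : Finset ι) (V : Finset κ) :
    ((U.card : K) + V.card) • contractionSum L M d U V
      = ∑ i ∈ U, L i * contractionSum L M d (U.erase i) V
        + ∑ j ∈ V, M j * contractionSum L M d U (V.erase j)
        + (2 : K) • ∑ i ∈ U, ∑ j ∈ V, d i j • contractionSum L M d (U.erase i) (V.erase j) := by
  have hterm : ∀ I ∈ U.powerset, ∀ J ∈ V.powerset,
      ((U.card : K) + V.card) • (bijSum d I J • symPair K L M (U \ I) (V \ J))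
        = ∑ i ∈ U \ I, L i * (bijSum d I J • symPair K L M (U.erase i \ I) (V \ J))
          + ∑ j ∈ V \ J, M j * (bijSum d I J • symPair K L M (U \ I) (V.erase j \ J))
          + (2 : K) • (((I.card : K) * bijSum d I J) • symPair K L M (U \ I) (V \ J)) := by
    intro I hI J hJ
    by_cases hc : J.card = I.card
    · have hU := card_sdiff_add_card_eq_card (mem_powerset.mp hI)
      have hV := card_sdiff_add_card_eq_card (mem_powerset.mp hJ)
      -- Unmatched elements count once and matched pairs twice: the former yield the front factors,
      -- the latter the coefficient `2` in the recursion.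
      have hs : ((U.card : K) + V.card)
          = (((U \ I).card : K) + (V \ J).card) + 2 * I.card := by
        rw [← hU, ← hV, hc]
        push_cast
        ring
      rw [hs, add_smul, smul_comm _ (bijSum d I J), card_add_card_smul_symPair, smul_add, smul_sum,
        smul_sum]
      simp_rw [mul_smul_comm, erase_sdiff_comm, smul_smul, mul_assoc]
    · simp [bijSum_eq_zero d hc]
  have h1 : ∑ I ∈ U.powerset, ∑ J ∈ V.powerset,
        ∑ i ∈ U \ I, L i * (bijSum d I J • symPair K L M (U.erase i \ I) (V \ J))
      = ∑ i ∈ U, L i * contractionSum L M d (U.erase i) V := by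
    simp_rw [contractionSum, mul_sum]
    rw [← sum_powerset_sum_sdiff U (fun I i => ∑ J ∈ V.powerset,
      L i * (bijSum d I J • symPair K L M (U.erase i \ I) (V \ J)))]
    exact sum_congr rfl fun I _ => sum_comm
  have h2 : ∑ I ∈ U.powerset, ∑ J ∈ V.powerset,
        ∑ j ∈ V \ J, M j * (bijSum d I J • symPair K L M (U \ I) (V.erase j \ J))
      = ∑ j ∈ V, M j * contractionSum L M d U (V.erase j) := by
    simp_rw [contractionSum, mul_sum]
    rw [sum_comm (s := V)]
    exact sum_congr rfl fun I _ => sum_powerset_sum_sdiff V (fun J j =>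
      M j * (bijSum d I J • symPair K L M (U \ I) (V.erase j \ J)))
  rw [contractionSum, smul_sum, ← h1, ← h2, ← sum_card_smul_contraction, smul_sum,
    ← sum_add_distrib, ← sum_add_distrib]
  refine sum_congr rfl fun I hI => ?_
  rw [smul_sum, smul_sum, ← sum_add_distrib, ← sum_add_distrib]
  exact sum_congr rfl fun J hJ => hterm I hI J hJ

theorem eq_contractionSum (L : ι → A) (M : κ → A) (d : ι → κ → K)
    (F : Finset ι → Finset κ → A) (h0 : F ∅ ∅ = 1)
    (hF : ∀ U V, ((U.card : K) + V.card) • F U V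
      = ∑ i ∈ U, L i * F (U.erase i) V + ∑ j ∈ V, M j * F U (V.erase j)
        + (2 : K) • ∑ i ∈ U, ∑ j ∈ V, d i j • F (U.erase i) (V.erase j))
    (U : Finset ι) (V : Finset κ) : F U V = contractionSum L M d U V := by
  induction hn : U.card + V.card using Nat.strong_induction_on generalizing U V with
  | _ n ih =>
    rcases Nat.eq_zero_or_pos n with rfl | hpos
    · obtain ⟨hU, hV⟩ := Nat.add_eq_zero_iff.mp hn
      rw [card_eq_zero.mp hU, card_eq_zero.mp hV, h0, contractionSum_empty]
    · have hne : (U.card : K) + V.card ≠ 0 := by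
        rw [← Nat.cast_add, hn]
        exact Nat.cast_ne_zero.mpr hpos.ne'
      refine smul_right_injective A hne ?_
      change ((U.card : K) + V.card) • _ = ((U.card : K) + V.card) • _
      rw [hF, card_add_card_smul_contractionSum]
      congr 1
      · congr 1
        · refine sum_congr rfl fun i hi => ?_
          have := card_erase_lt_of_mem hi
          rw [ih _ (by omega) _ _ rfl]
        · refine sum_congr rfl fun j hj => ?_
          have := card_erase_lt_of_mem hj
          rw [ih _ (by omega) _ _ rfl]
      · congr 1
        refine sum_congr rfl fun i hi => sum_congr rfl fun j hj => ?_
        have := card_erase_lt_of_mem hi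
        have := card_erase_lt_of_mem hj
        rw [ih _ (by omega) _ _ rfl]

theorem symFinset_mul_symFinset (L : ι → A) (M : κ → A) (d : ι → κ → K)
    (hd : ∀ i j, ⁅L i, M j⁆ = algebraMap K A (d i j)) (U : Finset ι) (V : Finset κ) :
    symFinset K L U * symFinset K M V
      = contractionSum L M (fun i j => (1 / 2) * d i j) U V := by
  refine eq_contractionSum L M _ (fun U V => symFinset K L U * symFinset K M V)
    (by simp [symFinset_empty]) (fun U V => ?_) U V
  -- A factor `M j` extracted from the second product must still pass the first one; this yields `d
  -- i j = 2 * (d i j / 2)`, the pair term of the recursion.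
  have hM (j : κ) : symFinset K L U * M j
      = M j * symFinset K L U + ∑ i ∈ U, d i j • symFinset K L (U.erase i) := by
    rw [symFinset_comm L (M j) (fun i => -d i j) (fun i => ?_) U]
    · simp
    · rw [map_neg, ← hd, Ring.lie_def]
      abel
  rw [add_smul, ← smul_mul_assoc, card_smul_symFinset, ← mul_smul_comm, card_smul_symFinset,
    sum_mul, mul_sum]
  simp_rw [← mul_assoc, hM, add_mul, sum_mul]
  rw [sum_add_distrib, ← add_assoc, sum_comm (s := V), smul_sum]
  congr 1
  refine sum_congr rfl fun i _ => ?_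
  rw [smul_sum]
  refine sum_congr rfl fun j _ => ?_
  rw [smul_smul, ← mul_assoc, mul_one_div_cancel two_ne_zero, one_mul, smul_mul_assoc]

theorem symFinset_mul_symFinset_swap (L : ι → A) (M : κ → A) (d : ι → κ → K)
    (hd : ∀ i j, ⁅L i, M j⁆ = algebraMap K A (d i j)) (U : Finset ι) (V : Finset κ) :
    symFinset K M V * symFinset K L U
      = contractionSum L M (fun i j => (-1 / 2) * d i j) U V := by
  refine eq_contractionSum L M _ (fun U V => symFinset K M V * symFinset K L U)
    (by simp [symFinset_empty]) (fun U V => ?_) U V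
  -- Now `L i` passes to the left of the `M` product, which reverses the sign of `d`.
  have hL (i : ι) : symFinset K M V * L i
      = L i * symFinset K M V + ∑ j ∈ V, (-d i j) • symFinset K M (V.erase j) := by
    rw [symFinset_comm M (L i) (fun j => d i j) (fun j => ?_) V]
    · simp
    · rw [← hd, Ring.lie_def]
      abel
  rw [add_smul, ← mul_smul_comm, card_smul_symFinset, ← smul_mul_assoc, card_smul_symFinset,
    sum_mul, mul_sum]
  simp_rw [← mul_assoc, hL, add_mul, sum_mul]
  rw [sum_add_distrib, add_right_comm, smul_sum]
  congr 1
  refine sum_congr rfl fun i _ => ?_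
  rw [smul_sum]
  refine sum_congr rfl fun j _ => ?_
  rw [smul_smul, ← mul_assoc, mul_div_cancel₀ _ two_ne_zero, neg_one_mul, smul_mul_assoc]

end Symmetrization

/-! ### Translation to increasing enumerations of subsets -/

section Parts

variable {h m : ℕ}

theorem Parts.elem_injective (I : Parts h m) : Function.Injective I.elem :=
  (I.1.orderEmbOfFin I.2).injective

theorem Parts.complElem_injective (I : Parts h m) : Function.Injective I.complElem :=
  ((I.1)ᶜ.orderEmbOfFin I.card_compl).injective

theorem Parts.image_elem (I : Parts h m) : univ.image I.elem = I.1 :=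
  image_orderEmbOfFin_univ _ _

theorem Parts.image_complElem (I : Parts h m) : univ.image I.complElem = (I.1)ᶜ :=
  image_orderEmbOfFin_univ _ _

theorem symProd_append_complElem {K A : Type*} [Field K] [CharZero K] [Ring A] [Algebra K A]
    {l : ℕ} (L : Fin l → A) (M : Fin m → A) (I : Parts h l) (J : Parts h m) :
    symProd K (Fin.append (fun s => L (I.complElem s)) (fun t => M (J.complElem t)))
      = symPair K L M (univ \ I.1) (univ \ J.1) := by
  set e : Fin (l - h + (m - h)) → Fin l ⊕ Fin m :=
    Fin.append (fun s => Sum.inl (I.complElem s)) (fun t => Sum.inr (J.complElem t)) with he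
  have hcomp : Fin.append (fun s => L (I.complElem s)) (fun t => M (J.complElem t))
      = fun r => Sum.elim L M (e r) := by
    funext r
    refine Fin.addCases (fun s => ?_) (fun t => ?_) r <;> simp [he]
  have hinj : Function.Injective e := by
    rw [he, Fin.append_injective_iff]
    refine ⟨Sum.inl_injective.comp I.complElem_injective,
      Sum.inr_injective.comp J.complElem_injective, fun s t => Sum.inl_ne_inr⟩
  rw [hcomp, symProd_comp_eq_symFinset _ e hinj, symPair]
  congr 1
  ext (a | a)
  · simp only [mem_image, mem_univ, true_and, inl_mem_disjSum, ← compl_eq_univ_sdiff,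
      ← I.image_complElem, he, finSumFinEquiv.surjective.exists, Sum.exists,
      finSumFinEquiv_apply_left, finSumFinEquiv_apply_right, Fin.append_left, Fin.append_right]
    simp
  · simp only [mem_image, mem_univ, true_and, inr_mem_disjSum, ← compl_eq_univ_sdiff,
      ← J.image_complElem, he, finSumFinEquiv.surjective.exists, Sum.exists,
      finSumFinEquiv_apply_left, finSumFinEquiv_apply_right, Fin.append_left, Fin.append_right]
    simp

theorem sum_sum_parts {B : Type*} [AddCommMonoid B] {l : ℕ} (H : Finset ℕ)
    (F : Finset (Fin l) → Finset (Fin m) → B)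
    (hF : ∀ I J, F I J ≠ 0 → J.card = I.card ∧ I.card ∈ H) :
    ∑ h ∈ H, ∑ I : Parts h l, ∑ J : Parts h m, F I.1 J.1
      = ∑ I ∈ univ.powerset, ∑ J ∈ univ.powerset, F I J := by
  have h1 (h : ℕ) : ∑ I : Parts h l, ∑ J : Parts h m, F I.1 J.1
      = ∑ I, ∑ J, if I.card = h ∧ J.card = h then F I J else 0 := by
    rw [← sum_subtype (univ.filter fun I : Finset (Fin l) => I.card = h) (by simp)
      (fun I => ∑ J : Parts h m, F I J.1), sum_filter]
    refine sum_congr rfl fun I _ => ?_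
    rw [← sum_subtype (univ.filter fun J : Finset (Fin m) => J.card = h) (by simp)
      (fun J => F I J), sum_filter]
    split_ifs with hI <;> simp [hI]
  simp_rw [h1, powerset_univ]
  rw [sum_comm]
  refine sum_congr rfl fun I _ => ?_
  rw [sum_comm]
  refine sum_congr rfl fun J _ => ?_
  by_cases h0 : F I J = 0
  · simp [h0]
  · obtain ⟨hc, hH⟩ := hF I J h0
    rw [sum_eq_single_of_mem I.card hH fun b _ hb => if_neg fun h => hb h.1.symm, if_pos ⟨rfl, hc⟩]

end Parts

/-! ### Cancellation of even matchings and the commutator formula -/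

theorem half_pow_sub_neg_half_pow_of_odd {K : Type*} [Field K] [CharZero K] {h : ℕ} (hh : Odd h) :
    (1 / 2 : K) ^ h - (-1 / 2) ^ h = 1 / 2 ^ (h - 1) := by
  obtain ⟨k, rfl⟩ := hh
  rw [neg_div, Odd.neg_pow ⟨k, rfl⟩, Nat.add_sub_cancel, pow_succ, div_pow, one_pow]
  ring

theorem mainTheorem9 {K A : Type*} [Field K] [CharZero K] [Ring A] [Algebra K A]
    (l m : ℕ) (L : Fin l → A) (M : Fin m → A) (d : Fin l → Fin m → K)
    (hd : ∀ i j, ⁅L i, M j⁆ = algebraMap K A (d i j)) :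
    ⁅symProd K L, symProd K M⁆ =
      ∑ h ∈ (Finset.Icc 1 (min l m)).filter Odd,
        ∑ I : Parts h l, ∑ J : Parts h m, ∑ π : Equiv.Perm (Fin h),
          ((1 / 2 ^ (h - 1) : K) * ∏ r : Fin h, d (I.elem r) (J.elem (π r))) •
            symProd K (Fin.append (fun s => L (I.complElem s)) (fun t => M (J.complElem t))) := by
  have hS {n : ℕ} (x : Fin n → A) : symProd K x = symFinset K x univ := by
    simpa using symProd_comp_eq_symFinset (K := K) x id Function.injective_id
  rw [hS, hS, Ring.lie_def, symFinset_mul_symFinset L M d hd,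
    symFinset_mul_symFinset_swap L M d hd, contractionSum, contractionSum, ← sum_sub_distrib]
  simp_rw [← sum_sub_distrib, ← sub_smul, bijSum_smul, ← sub_mul]
  rw [← sum_sum_parts ((Icc 1 (min l m)).filter Odd)]
  · refine sum_congr rfl fun h hh => sum_congr rfl fun I _ => sum_congr rfl fun J _ => ?_
    rw [← sum_smul, ← mul_sum, sum_perm_prod_eq_bijSum d _ _ I.elem_injective J.elem_injective,
      I.image_elem, J.image_elem, symProd_append_complElem, I.2,
      half_pow_sub_neg_half_pow_of_odd (mem_filter.mp hh).2]
  · intro I J hne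
    have hc : J.card = I.card := by
      by_contra hc
      exact hne (by rw [bijSum_eq_zero d hc, mul_zero, zero_smul])
    -- For even size the weights `(1/2)^h` and `(-1/2)^h` agree, so the term vanishes.
    have hodd : Odd I.card := by
      by_contra hev
      rw [Nat.not_odd_iff_even] at hev
      exact hne (by rw [neg_div, hev.neg_pow, sub_self, zero_mul, zero_smul])
    have hl := card_le_univ I
    have hm := card_le_univ J
    rw [Fintype.card_fin] at hl hm
    exact ⟨hc, mem_filter.mpr ⟨mem_Icc.mpr ⟨hodd.pos, le_min hl (hc ▸ hm)⟩, hodd⟩⟩
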